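/- Let $A\in\{0,1\}^{m\times n}$, $b\in\mathbb Z^m$, $w\in\mathbb R^n$ and $X\in\mathbb N^n$, and assume that the covering LP $$\min\{w^Tx \mid Ax\ge b,\ 0\le x_i\le X_i \text{ for all } i\}$$ is feasible. Let $\mathrm{OPT}_{LP}$ denote its set of optimal solutions, and for $r\in\{1,\dots,n\}$ put $x_r^{\min}=\min\{x_r\mid x\in \mathrm{OPT}_{LP}\}$ and $x_r^{\max}=\max\{x_r\mid x\in \mathrm{OPT}_{LP}\}$. The min-sum-covering algorithm with $t\in\mathbb N$ iterations runs the following min-sum-packing algorithm for the complementary packing problem $\max\{w^Tx\mid Ax\le d,\ x_i\in\{0,\dots,X_i\} \text{ for all } i\}$ with $d=AX-b$. Let $\mathcal N$ denote neighbourhoods in the bipartite graph with variable vertices $v\in\{1,\dots,n\}$, constraint vertices $C\in\{1,\dots,m\}$, and an edge $(v,C)$ whenever $A_{Cv}=1$. For every edge $(v,C)$ and every $\beta\in\{0,\dots,X_v\}$ set $\mu^{(0)}_{C\to v}(\beta)=0$, and for $t'=1,\dots,t$ $$\mu^{(t')}_{v\to C}(\beta)=w_v\beta+\sum_{C'\in\mathcal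 N(v)\setminus\{C\}}\mu^{(t'-1)}_{C'\to v}(\beta),$$ $$\mu^{(t')}_{C\to v}(\beta)=\max\Big\{\sum_{u\in\mathcal N(C)\setminus\{v\}}\mu^{(t')}_{u\to C}(z_u)\ \Big|\ z\in\prod_{i}\{0,\dots,X_i\},\ z_v=\beta,\ \sum_{u\in\mathcal N(C)}z_u\le d_C\Big\},$$ where $\max\emptyset=-\infty$. Finally let $\mu_v(\beta)=w_v\beta+\sum_{C\in\mathcal N(v)}\mu^{(t)}_{C\to v}(\beta)$. The set of optimal values of min-sum-covering at the variable vertex $r$ after $t$ iterations is $$\delta_{r,t}=\{X_r-\beta\mid \beta\in\{0,\dots,X_r\},\ \mu_r(\beta)=\max_{0\le\beta'\le X_r}\mu_r(\beta')\}.$$ Then for every $r$ the following hold. 1. If $t$ is even, then $\min\delta_{r,t}\le x_r^{\min}$. 2. If $t$ is odd, then $\max\delta_{r,t}\ge x_r^{\max}$. -/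

import Mathlib

namespace MinSum

/-- The factor graph model of an integer program with variable vertices `V` and constraint
vertices `C`. The bipartite graph on `V ∪ C` is given by its incidence relation `Adj`; the alphabet
of a variable vertex `v` is `{0, …, X v}`; the factor function `ψ c` takes the value `⊥` (that is,
`-∞`) on the assignments which violate the constraint `c`. -/
structure FactorGraphModel (V C : Type*) where
  Adj : V → C → Prop
  ψ : C → (V → ℕ) → WithBot ℝ
  φ : V → ℕ → ℝ
  X : V → ℕ

namespace FactorGraphModel

variable {V C : Type*} [Fintype V] [Fintype C] [DecidableEq V] [DecidableEq C]

open Classical in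
/-- The neighbours of a variable vertex. -/
noncomputable def varNbrs (F : FactorGraphModel V C) (v : V) : Finset C :=
  Finset.univ.filter fun c => F.Adj v c

open Classical in
/-- The neighbours of a constraint vertex. -/
noncomputable def conNbrs (F : FactorGraphModel V C) (c : C) : Finset V :=
  Finset.univ.filter fun v => F.Adj v c

/-- The integral box `{0, …, X v₁} × ⋯ × {0, …, X vₙ}`. -/
def zbox (F : FactorGraphModel V C) : Finset (V → ℕ) :=
  Fintype.piFinset fun v => Finset.range (F.X v + 1)

/-- The variable-to-constraint message, computed from the previous constraint-to-variable
messages `μ`. -/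
noncomputable def varMessage (F : FactorGraphModel V C) (μ : C → V → ℕ → WithBot ℝ)
    (v : V) (c : C) (β : ℕ) : WithBot ℝ :=
  (F.φ v β : WithBot ℝ) + ∑ c' ∈ (F.varNbrs v).erase c, μ c' v β

open Classical in
/-- The constraint-to-variable message, computed from the variable-to-constraint messages `ν` of
the same iteration. The maximum over the empty set is `-∞`. -/
noncomputable def conMessage (F : FactorGraphModel V C) (ν : V → C → ℕ → WithBot ℝ)
    (c : C) (v : V) (β : ℕ) : WithBot ℝ :=
  (F.zbox.filter fun z => z v = β ∧ F.ψ c z = 0).sup fun z =>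
    ∑ u ∈ (F.conNbrs c).erase v, ν u c (z u)

/-- The constraint-to-variable messages after `t` iterations, with zero initialization. Only the
values at adjacent pairs and at letters `β ≤ X v` are ever used. -/
noncomputable def message (F : FactorGraphModel V C) : ℕ → C → V → ℕ → WithBot ℝ
  | 0 => fun _ _ _ => 0
  | t + 1 => F.conMessage (F.varMessage (F.message t))

/-- The final value computed by the variable vertex `v` for the letter `β`. -/
noncomputable def finalValue (F : FactorGraphModel V C) (t : ℕ) (v : V) (β : ℕ) : WithBot ℝ :=
  (F.φ v β : WithBot ℝ) + ∑ c ∈ F.varNbrs v, F.message t c v β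

open Classical in
/-- The set `δ_{v,t}` of the letters that maximize the final value at `v` in the execution of
min-sum-packing with `t` iterations. -/
noncomputable def packingDelta (F : FactorGraphModel V C) (t : ℕ) (v : V) : Finset ℕ :=
  (Finset.range (F.X v + 1)).filter fun β =>
    F.finalValue t v β = (Finset.range (F.X v + 1)).sup (F.finalValue t v)

end FactorGraphModel

open Classical in
/-- The factor graph model of the packing integer program
`argmax {wᵀ x | A x ≤ d, x integral, 0 ≤ x ≤ X}`, for a zero-one matrix `A`. -/
noncomputable def packingModel {m n : ℕ} (A : Matrix (Fin m) (Fin n) ℤ) (d : Fin m → ℤ)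
    (w : Fin n → ℝ) (X : Fin n → ℕ) : FactorGraphModel (Fin n) (Fin m) where
  Adj i j := A j i = 1
  ψ j y := if ∑ i ∈ Finset.univ.filter (fun i => A j i = 1), (y i : ℤ) ≤ d j then 0 else ⊥
  φ i β := w i * (β : ℝ)
  X := X

/-- The set `δ_{r,t}` of the execution of min-sum-covering with `t` iterations on the covering
problem given by `A`, `b`, `w`, `X`: the algorithm runs min-sum-packing on the packing problem with
right-hand side `A X - b`, and complements the values `β` found there to `X r - β`. (These
`β` are at most `X r`, so the subtraction is not truncated.) -/
noncomputable def coveringDelta {m n : ℕ} (A : Matrix (Fin m) (Fin n) ℤ) (b : Fin m → ℤ)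
    (w : Fin n → ℝ) (X : Fin n → ℕ) (t : ℕ) (r : Fin n) : Finset ℕ :=
  ((packingModel A (A.mulVec (fun i => (X i : ℤ)) - b) w X).packingDelta t r).image
    fun β => X r - β

/-- The feasible region of the covering LP: `A x ≥ b` and `0 ≤ x ≤ X`. -/
def coveringFeasible {m n : ℕ} (A : Matrix (Fin m) (Fin n) ℤ) (b : Fin m → ℤ)
    (X : Fin n → ℕ) : Set (Fin n → ℝ) :=
  {x | (∀ j, (b j : ℝ) ≤ ∑ i, (A j i : ℝ) * x i) ∧ ∀ i, 0 ≤ x i ∧ x i ≤ (X i : ℝ)}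

/-- The set of optimal solutions of the covering LP. -/
def coveringOpt {m n : ℕ} (A : Matrix (Fin m) (Fin n) ℤ) (b : Fin m → ℤ)
    (w : Fin n → ℝ) (X : Fin n → ℕ) : Set (Fin n → ℝ) :=
  {x | x ∈ coveringFeasible A b X ∧
    ∀ y ∈ coveringFeasible A b X, ∑ i, w i * x i ≤ ∑ i, w i * y i}

end MinSum

/-! Complementing `x ↦ X - x` turns the covering LP into a packing LP. Let `y` be an optimal dual
solution for the latter, with complementary slackness against the given primal optimum `x`. In
iteration `t`, moving the argument of the message from a constraint `c` to a variable `v` by the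
unit step `s = (-1) ^ t` towards `x v` raises that message by at least `-s * y c`. Indeed, either
another variable at `c` can absorb the step by moving by `-s` towards its own optimal value, which
gains `-s * y c` by induction, or there is room for the step alone, and then `-s * y c ≤ 0`. The
variable vertices preserve the invariant because the reduced cost of `v` has the sign of `s`
whenever a step `s` towards `x v` is possible. At the root, the gains add up to `s` times the
reduced cost, hence a maximizing letter that can still move by `s` towards `x v` remains maximizing
after the move, and some maximizing letter cannot move any more. -/

namespace MinSum

open Finset

section LinearProgramming

variable {𝕜 E ι : Type*} [Field 𝕜] [LinearOrder 𝕜] [IsStrictOrderedRing 𝕜] [AddCommGroup E]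
  [Module 𝕜 E]

theorem farkas (s : Finset ι) (a : ι → Module.Dual 𝕜 E) (f : Module.Dual 𝕜 E)
    (h : ∀ x, (∀ i ∈ s, 0 ≤ a i x) → 0 ≤ f x) :
    ∃ y : ι → 𝕜, 0 ≤ y ∧ f = ∑ i ∈ s, y i • a i := by
  classical
  induction s using Finset.induction_on generalizing a f with
  | empty =>
    have hf : ∀ x, 0 ≤ f x := fun x => h x (by simp)
    refine ⟨0, le_rfl, LinearMap.ext fun x => ?_⟩
    simpa using le_antisymm (by simpa using hf (-x)) (hf x)
  | insert j s hj ih =>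
    suffices ∃ (y : ι → 𝕜) (c : 𝕜), 0 ≤ y ∧ 0 ≤ c ∧ f = c • a j + ∑ i ∈ s, y i • a i by
      obtain ⟨y, c, hy, hc, rfl⟩ := this
      refine ⟨Function.update y j c, le_update_iff.2 ⟨hc, fun i _ => hy i⟩, ?_⟩
      rw [sum_insert hj, Function.update_self]
      refine congrArg _ (sum_congr rfl fun i hi => ?_)
      rw [Function.update_of_ne (ne_of_mem_of_not_mem hi hj)]
    by_cases hs : ∀ x, (∀ i ∈ s, 0 ≤ a i x) → 0 ≤ f x
    · obtain ⟨y, hy, rfl⟩ := ih a f hs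
      exact ⟨y, 0, hy, le_rfl, by simp⟩
    obtain ⟨p, hp, hfp, hjp⟩ : ∃ p, (∀ i ∈ s, 0 ≤ a i p) ∧ f p < 0 ∧ a j p = -1 := by
      push Not at hs
      obtain ⟨q, hq, hfq⟩ := hs
      have hjq : a j q < 0 := by
        by_contra! hjq
        exact hfq.not_ge (h q (by simpa [hjq] using hq))
      have hpos : 0 < (-a j q)⁻¹ := inv_pos.2 (neg_pos.2 hjq)
      refine ⟨(-a j q)⁻¹ • q, fun i hi => ?_, ?_, ?_⟩
      · simpa using mul_nonneg hpos.le (hq i hi)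
      · simpa using mul_neg_of_pos_of_neg hpos hfq
      · simp [hjq.ne]
    -- Precompose with the projection `x ↦ x + a j x • p` onto the kernel of `a j`.
    obtain ⟨y, hy, hfy⟩ := ih (fun i => a i + a i p • a j) (f + f p • a j) fun x hx => by
      simpa [mul_comm] using h (x + a j x • p) (by simpa [hjp, mul_comm] using hx)
    refine ⟨y, ∑ i ∈ s, y i * a i p - f p, hy, ?_, ?_⟩
    · linarith [sum_nonneg fun i hi => mul_nonneg (hy i) (hp i hi)]
    · simp only [smul_add, sum_add_distrib, smul_smul, ← sum_smul] at hfy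
      linear_combination (norm := module) hfy

theorem exists_pos_forall_add_smul_le [Finite ι] {a : ι → Module.Dual 𝕜 E} {b : ι → 𝕜} {x v : E}
    (hx : ∀ i, a i x ≤ b i) (hv : ∀ i, a i x = b i → a i v ≤ 0) :
    ∃ ε > (0 : 𝕜), ∀ i, a i (x + ε • v) ≤ b i := by
  cases nonempty_fintype ι
  obtain ⟨M, hM, hMv⟩ : ∃ M > (0 : 𝕜), ∀ i, a i v ≤ M * (b i - a i x) := by
    have hquot (i : ι) : 0 ≤ |a i v| / (b i - a i x) :=
      div_nonneg (abs_nonneg _) (sub_nonneg.2 (hx i))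
    have hM : 0 ≤ ∑ i, |a i v| / (b i - a i x) := sum_nonneg fun i _ => hquot i
    refine ⟨∑ i, |a i v| / (b i - a i x) + 1, by linarith, fun i => ?_⟩
    rcases (hx i).eq_or_lt with htight | hslack
    · simpa [htight] using hv i htight
    · have hle := single_le_sum (fun i _ => hquot i) (mem_univ i)
      calc a i v ≤ |a i v| / (b i - a i x) * (b i - a i x) := by
            rw [div_mul_cancel₀ _ (sub_pos.2 hslack).ne']
            exact le_abs_self _
        _ ≤ _ := mul_le_mul_of_nonneg_right (by linarith) (sub_pos.2 hslack).le
  refine ⟨M⁻¹, inv_pos.2 hM, fun i => ?_⟩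
  have := (inv_mul_le_iff₀ hM).2 (hMv i)
  simp only [map_add, map_smul, smul_eq_mul]
  linarith

theorem exists_multipliers_of_forall_le [Fintype ι] {a : ι → Module.Dual 𝕜 E} {b : ι → 𝕜}
    {f : Module.Dual 𝕜 E} {x : E} (hx : ∀ i, a i x ≤ b i)
    (hmax : ∀ z, (∀ i, a i z ≤ b i) → f z ≤ f x) :
    ∃ y : ι → 𝕜, 0 ≤ y ∧ f = ∑ i, y i • a i ∧ ∀ i, a i x < b i → y i = 0 := by
  classical
  obtain ⟨y, hy, hfy⟩ := farkas {i | a i x = b i} a f fun v hv => by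
    obtain ⟨ε, hε, hfeas⟩ := exists_pos_forall_add_smul_le (v := -v) hx fun i hi => by
      simpa using hv i (by simpa using hi)
    have hle := hmax _ hfeas
    simp only [map_add, map_smul, map_neg, smul_eq_mul] at hle
    exact nonneg_of_mul_nonneg_right (by linarith) hε
  refine ⟨fun i => if a i x = b i then y i else 0, fun i => ?_, ?_, fun i hi => if_neg hi.ne⟩
  · dsimp only
    split_ifs
    exacts [hy i, le_rfl]
  · simp [hfy, sum_filter, ite_smul]

end LinearProgramming

namespace FactorGraphModel

variable {V C : Type*}

section Polytope

variable {F : FactorGraphModel V C} {d : C → ℤ} {w : V → ℝ} {x : V → ℝ} {y : C → ℝ}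

/-- The feasible region of the packing LP with right-hand side `d` on the factor graph `F`. -/
def packingPolytope [Fintype V] (F : FactorGraphModel V C) (d : C → ℤ) : Set (V → ℝ) :=
  {x | (∀ c, ∑ v ∈ F.conNbrs c, x v ≤ d c) ∧ ∀ v, 0 ≤ x v ∧ x v ≤ F.X v}

/-- The reduced cost of the variable `v` in the packing LP with weights `w`, for the multipliers `y`
of the constraints. -/
noncomputable def reducedCost [Fintype C] (F : FactorGraphModel V C) (w : V → ℝ) (y : C → ℝ)
    (v : V) : ℝ :=
  w v - ∑ c ∈ F.varNbrs v, y c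

/-- `x` and `y` are optimal solutions of the packing LP and of its dual, as witnessed by
complementary slackness. The dual variables of the box constraints are left implicit: they are the
positive and negative parts of the reduced cost. -/
structure IsOptimalPair [Fintype V] [Fintype C] (F : FactorGraphModel V C) (d : C → ℤ)
    (w : V → ℝ) (x : V → ℝ) (y : C → ℝ) : Prop where
  mem_packingPolytope : x ∈ F.packingPolytope d
  nonneg : ∀ c, 0 ≤ y c
  eq_zero_of_slack : ∀ c, ∑ v ∈ F.conNbrs c, x v < d c → y c = 0
  reducedCost_nonneg : ∀ v, 0 < x v → 0 ≤ F.reducedCost w y v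
  reducedCost_nonpos : ∀ v, x v < F.X v → F.reducedCost w y v ≤ 0

theorem mem_varNbrs [Fintype C] {v : V} {c : C} : c ∈ F.varNbrs v ↔ F.Adj v c := by
  simp [varNbrs]

theorem mem_conNbrs [Fintype V] {v : V} {c : C} : v ∈ F.conNbrs c ↔ F.Adj v c := by
  simp [conNbrs]

theorem exists_isOptimalPair [Fintype V] [Fintype C] (hx : x ∈ F.packingPolytope d)
    (hmax : ∀ z ∈ F.packingPolytope d, ∑ v, w v * z v ≤ ∑ v, w v * x v) :
    ∃ y, F.IsOptimalPair d w x y := by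
  classical
  let a : C ⊕ V ⊕ V → Module.Dual ℝ (V → ℝ) :=
    Sum.elim (fun c => ∑ v ∈ F.conNbrs c, LinearMap.proj v)
      (Sum.elim (fun v => -LinearMap.proj v) fun v => LinearMap.proj v)
  let b : C ⊕ V ⊕ V → ℝ := Sum.elim (fun c => d c) (Sum.elim 0 fun v => F.X v)
  have hfeas (z : V → ℝ) : (∀ i, a i z ≤ b i) ↔ z ∈ F.packingPolytope d := by
    simp [a, b, packingPolytope, forall_and]
  obtain ⟨y, hy, hwy, hslack⟩ := exists_multipliers_of_forall_le (f := ∑ v, w v • LinearMap.proj v)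
    ((hfeas x).2 hx) fun z hz => by simpa using hmax z ((hfeas z).1 hz)
  have hcost (v : V) : F.reducedCost w (y ∘ Sum.inl) v =
      y (.inr (.inr v)) - y (.inr (.inl v)) := by
    have hv : w v = ∑ c ∈ F.varNbrs v, y (.inl c) + (-y (.inr (.inl v)) + y (.inr (.inr v))) := by
      simpa [a, Pi.single_apply, mem_conNbrs, varNbrs, sum_filter]
        using LinearMap.congr_fun hwy (Pi.single v 1)
    simp only [reducedCost, Function.comp_apply]
    linarith
  refine ⟨y ∘ Sum.inl, hx, fun c => hy _, fun c hc => hslack _ (by simpa [a, b] using hc),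
    fun v hv => ?_, fun v hv => ?_⟩
  · rw [hcost, hslack (.inr (.inl v)) (by simpa [a, b] using hv), sub_zero]
    exact hy _
  · rw [hcost, hslack (.inr (.inr v)) (by simpa [a, b] using hv), zero_sub]
    exact neg_nonpos.2 (hy _)

end Polytope

section Steps

/-- From the letter `β`, the unit step `s` goes in the direction of the real number `ξ`, and it ends
at the letter `β'`. The alphabet is `{0, …, N}`. -/
structure IsStepTowards (N : ℕ) (ξ : ℝ) (s : ℤˣ) (β β' : ℕ) : Prop where
  source_le : β ≤ N
  target_le : β' ≤ N
  target_eq : (β' : ℤ) = β + s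
  towards : 0 < (s : ℝ) * (ξ - β)

variable {N : ℕ} {ξ a a' : ℝ} {s : ℤˣ} {β β' : ℕ} {f : ℕ → WithBot ℝ}

theorem exists_isStepTowards (h₀ : 0 ≤ ξ) (hN : ξ ≤ N) (hβ : β ≤ N) (h : 0 < (s : ℝ) * (ξ - β)) :
    ∃ β', IsStepTowards N ξ s β β' := by
  rcases Int.units_eq_one_or s with rfl | rfl
  · have hlt : (β : ℝ) < N := by
      simp only [Units.val_one, Int.cast_one, one_mul] at h
      linarith
    exact ⟨β + 1, hβ, by exact_mod_cast hlt, by simp, h⟩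
  · have hpos : (0 : ℝ) < β := by
      simp only [Units.val_neg, Units.val_one, Int.cast_neg, Int.cast_one] at h
      linarith
    obtain ⟨γ, rfl⟩ := Nat.exists_eq_add_one.2 (Nat.cast_pos.1 hpos)
    exact ⟨γ, hβ, by omega, by simp, h⟩

/-- Every unit step `s` in the direction of `ξ` raises the value of `f` by at least `a`. -/
def GainsTowards (N : ℕ) (ξ : ℝ) (s : ℤˣ) (a : ℝ) (f : ℕ → WithBot ℝ) : Prop :=
  ∀ ⦃β β' : ℕ⦄, IsStepTowards N ξ s β β' → f β + (a : WithBot ℝ) ≤ f β'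

theorem GainsTowards.mono (h : GainsTowards N ξ s a f)
    (ha : ∀ ⦃β β'⦄, IsStepTowards N ξ s β β' → a' ≤ a) : GainsTowards N ξ s a' f :=
  fun _ _ hβ => (add_le_add_right (WithBot.coe_le_coe.2 (ha hβ)) _).trans (h hβ)

variable {F : FactorGraphModel V C} {d : C → ℤ} {w : V → ℝ} {x : V → ℝ} {y : C → ℝ}

theorem IsOptimalPair.reducedCost_gain_nonneg [Fintype V] [Fintype C]
    (h : F.IsOptimalPair d w x y) {v : V} (hβ : IsStepTowards (F.X v) (x v) s β β') :
    0 ≤ (s : ℝ) * F.reducedCost w y v := by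
  have htowards := hβ.towards
  rcases Int.units_eq_one_or s with rfl | rfl
  · simp only [Units.val_one, Int.cast_one, one_mul] at htowards ⊢
    exact h.reducedCost_nonneg v (by linarith [β.cast_nonneg (α := ℝ)])
  · simp only [Units.val_neg, Units.val_one, Int.cast_neg, Int.cast_one] at htowards ⊢
    have hβX : (β : ℝ) ≤ F.X v := by exact_mod_cast hβ.source_le
    linarith [h.reducedCost_nonpos v (by linarith)]

theorem exists_opposite_step_or_slack {S : Finset V} {u : V} {b : ℤ} {X z : V → ℕ}
    (hu : u ∈ S) (hx : ∀ v, 0 ≤ x v ∧ x v ≤ X v) (hxb : ∑ v ∈ S, x v ≤ b) (hz : ∀ v, z v ≤ X v)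
    (hzb : ∑ v ∈ S, (z v : ℤ) ≤ b) (h : 0 < (s : ℝ) * (x u - z u)) :
    (∃ v ∈ S, v ≠ u ∧ ∃ γ, IsStepTowards (X v) (x v) (-s) (z v) γ) ∨
      ∑ v ∈ S, (z v : ℤ) + s ≤ b ∧ (s = 1 ∨ ∑ v ∈ S, x v < b) := by
  refine or_iff_not_imp_left.2 fun hno => ?_
  have htowards : ∀ v ∈ S, 0 ≤ (s : ℝ) * (x v - z v) := by
    intro v hv
    rcases eq_or_ne v u with rfl | hvu
    · exact h.le
    by_contra! hlt
    exact hno ⟨v, hv, hvu, exists_isStepTowards (hx v).1 (hx v).2 (hz v) (by push_cast; linarith)⟩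
  have hsum : 0 < (s : ℝ) * (∑ v ∈ S, x v - ∑ v ∈ S, (z v : ℝ)) := by
    rw [← sum_sub_distrib, mul_sum]
    exact sum_pos' htowards ⟨u, hu, h⟩
  rcases Int.units_eq_one_or s with rfl | rfl
  · have hlt : ∑ v ∈ S, (z v : ℝ) < b := by
      simp only [Units.val_one, Int.cast_one, one_mul] at hsum
      linarith
    exact ⟨Int.add_one_le_iff.2 (by exact_mod_cast hlt), .inl rfl⟩
  · have hzb' : ∑ v ∈ S, (z v : ℝ) ≤ b := by exact_mod_cast hzb
    simp only [Units.val_neg, Units.val_one, Int.cast_neg, Int.cast_one] at hsum ⊢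
    exact ⟨by linarith, .inr (by linarith)⟩

end Steps

section Messages

/-- `F` is the factor graph model of the packing integer program with zero-one constraints, weights
`w` and right-hand side `d`. -/
structure IsPacking [Fintype V] (F : FactorGraphModel V C) (d : C → ℤ) (w : V → ℝ) : Prop where
  ψ_eq_zero_iff : ∀ c z, F.ψ c z = 0 ↔ ∑ v ∈ F.conNbrs c, (z v : ℤ) ≤ d c
  φ_eq : ∀ v β, F.φ v β = w v * β

variable {F : FactorGraphModel V C} {d : C → ℤ} {w : V → ℝ} {x : V → ℝ} {y : C → ℝ} {s : ℤˣ}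
  {ν : V → C → ℕ → WithBot ℝ} {μ : C → V → ℕ → WithBot ℝ} {c : C} {u v : V}

theorem mem_zbox [Fintype V] [DecidableEq V] {z : V → ℕ} : z ∈ F.zbox ↔ z ≤ F.X := by
  simp [zbox, Pi.le_def]

theorem sum_le_conMessage [Fintype V] [DecidableEq V] (hF : F.IsPacking d w) {z : V → ℕ} {β : ℕ}
    (hz : z ≤ F.X) (hzu : z u = β) (hzc : ∑ v ∈ F.conNbrs c, (z v : ℤ) ≤ d c) :
    ∑ v ∈ (F.conNbrs c).erase u, ν v c (z v) ≤ F.conMessage ν c u β :=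
  le_sup (f := fun z : V → ℕ => ∑ v ∈ (F.conNbrs c).erase u, ν v c (z v))
    (by simpa using ⟨mem_zbox.2 hz, hzu, (hF.ψ_eq_zero_iff c z).2 hzc⟩)

theorem conMessage_add_le [Fintype V] [DecidableEq V] (hF : F.IsPacking d w) {β : ℕ}
    {a b : WithBot ℝ} (h : ∀ z ≤ F.X, z u = β → ∑ v ∈ F.conNbrs c, (z v : ℤ) ≤ d c →
      ∑ v ∈ (F.conNbrs c).erase u, ν v c (z v) + a ≤ b) :
    F.conMessage ν c u β + a ≤ b := by
  refine sup_induction (p := fun m => m + a ≤ b) (by simp)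
    (fun m hm m' hm' => max_add_add_right m m' a ▸ max_le hm hm') fun z hz => ?_
  obtain ⟨hzX, hzu, hzc⟩ := mem_filter.1 hz
  exact h z (mem_zbox.1 hzX) hzu ((hF.ψ_eq_zero_iff c z).1 hzc)

theorem sum_cast_update_of_eq_add [DecidableEq V] {S : Finset V} {z : V → ℕ} {β : ℕ} {k : ℤ}
    (hu : u ∈ S) (hβ : (β : ℤ) = z u + k) :
    ∑ v ∈ S, (Function.update z u β v : ℤ) = ∑ v ∈ S, (z v : ℤ) + k := by
  rw [← add_sum_erase _ _ hu, ← add_sum_erase _ _ hu, Function.update_self, hβ, add_right_comm]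
  exact congrArg (_ + · + k)
    (sum_congr rfl fun v hv => by rw [Function.update_of_ne (ne_of_mem_erase hv)])

theorem gainsTowards_conMessage [Fintype V] [Fintype C] [DecidableEq V] (hF : F.IsPacking d w)
    (h : F.IsOptimalPair d w x y) (hu : u ∈ F.conNbrs c)
    (hν : ∀ v ∈ F.conNbrs c, GainsTowards (F.X v) (x v) (-s) (-(s : ℝ) * y c) (ν v c)) :
    GainsTowards (F.X u) (x u) s (-(s : ℝ) * y c) (F.conMessage ν c u) := by
  intro β β' hβ
  refine conMessage_add_le hF fun z hz hzu hzc => ?_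
  subst hzu
  have hzX' : Function.update z u β' ≤ F.X := update_le_iff.2 ⟨hβ.target_le, fun v _ => hz v⟩
  have hzc' := sum_cast_update_of_eq_add hu hβ.target_eq
  obtain ⟨hxc, hxX⟩ := h.mem_packingPolytope
  rcases exists_opposite_step_or_slack hu hxX (hxc c) hz hzc hβ.towards with
    ⟨v, hv, hvu, γ, hγ⟩ | ⟨hroom, hs⟩
  · have hvu' : v ∈ (F.conNbrs c).erase u := mem_erase.2 ⟨hvu, hv⟩
    have hzγ : (γ : ℤ) = Function.update z u β' v + -(s : ℤ) := by
      simpa [Function.update_of_ne hvu] using hγ.target_eq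
    refine le_trans ?_ (sum_le_conMessage hF (z := Function.update (Function.update z u β') v γ)
      (update_le_iff.2 ⟨hγ.target_le, fun i _ => hzX' i⟩)
      (by rw [Function.update_of_ne hvu.symm, Function.update_self]) ?_)
    · rw [← add_sum_erase _ _ hvu', ← add_sum_erase _ _ hvu', Function.update_self, add_right_comm]
      refine add_le_add (hν v hv hγ) (sum_le_sum fun i hi => le_of_eq ?_)
      rw [Function.update_of_ne (ne_of_mem_erase hi),
        Function.update_of_ne (ne_of_mem_erase (mem_of_mem_erase hi))]
    · rwa [sum_cast_update_of_eq_add hv hzγ, hzc', add_neg_cancel_right]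
  · have hsy : -(s : ℝ) * y c ≤ 0 := by
      rcases hs with rfl | hslack
      · simpa using h.nonneg c
      · simp [h.eq_zero_of_slack c hslack]
    refine le_trans ?_ (sum_le_conMessage hF hzX' (Function.update_self ..) (hzc'.trans_le hroom))
    refine (add_le_of_nonpos_right (by exact_mod_cast hsy)).trans (sum_le_sum fun i hi => ?_)
    rw [Function.update_of_ne (ne_of_mem_erase hi)]

theorem gainsTowards_add_sum [Fintype V] (hF : F.IsPacking d w) (S : Finset C)
    (hμ : ∀ c ∈ S, GainsTowards (F.X v) (x v) s (-(s : ℝ) * y c) (μ c v)) :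
    GainsTowards (F.X v) (x v) s (s * (w v - ∑ c ∈ S, y c))
      (fun β => F.φ v β + ∑ c ∈ S, μ c v β) := by
  intro β β' hβ
  have hβ' : (β' : ℝ) = β + s := by exact_mod_cast hβ.target_eq
  calc (F.φ v β : WithBot ℝ) + ∑ c ∈ S, μ c v β + ((s * (w v - ∑ c ∈ S, y c) : ℝ) : WithBot ℝ)
      = F.φ v β' + ∑ c ∈ S, (μ c v β + ((-(s : ℝ) * y c : ℝ) : WithBot ℝ)) := by
        have hsplit : s * (w v - ∑ c ∈ S, y c) = w v * s + ∑ c ∈ S, -(s : ℝ) * y c := by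
          rw [← mul_sum]
          ring
        rw [hsplit, sum_add_distrib, hF.φ_eq, hF.φ_eq, hβ', mul_add, WithBot.coe_add,
          WithBot.coe_add, WithBot.coe_sum, add_add_add_comm]
    _ ≤ F.φ v β' + ∑ c ∈ S, μ c v β' := add_le_add_right (sum_le_sum fun c hc => hμ c hc hβ) _

theorem gainsTowards_varMessage [Fintype V] [Fintype C] [DecidableEq C] (hF : F.IsPacking d w)
    (h : F.IsOptimalPair d w x y) (hv : v ∈ F.conNbrs c)
    (hμ : ∀ c ∈ F.varNbrs v, GainsTowards (F.X v) (x v) s (-(s : ℝ) * y c) (μ c v)) :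
    GainsTowards (F.X v) (x v) s (s * y c) (F.varMessage μ v c) := by
  refine (gainsTowards_add_sum hF _ fun c' hc' => hμ c' (mem_of_mem_erase hc')).mono
    fun β β' hβ => ?_
  have hcost := h.reducedCost_gain_nonneg hβ
  rw [reducedCost, ← sum_erase_add _ _ (mem_varNbrs.2 (mem_conNbrs.1 hv))] at hcost
  linarith

variable [Fintype V] [Fintype C] [DecidableEq V] [DecidableEq C]

theorem gainsTowards_message (hF : F.IsPacking d w) (h : F.IsOptimalPair d w x y) (t : ℕ)
    (hv : v ∈ F.conNbrs c) :
    GainsTowards (F.X v) (x v) ((-1) ^ t) (-(((-1) ^ t : ℤˣ) : ℝ) * y c) (F.message t c v) := by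
  induction t generalizing v c with
  | zero =>
    intro β β' _
    simpa [message] using mod_cast h.nonneg c
  | succ t ih =>
    refine gainsTowards_conMessage hF h hv fun u hu => ?_
    simpa [pow_succ] using gainsTowards_varMessage hF h hu fun c' hc' =>
      ih (mem_conNbrs.2 (mem_varNbrs.1 hc'))

theorem gainsTowards_finalValue (hF : F.IsPacking d w) (h : F.IsOptimalPair d w x y) (t : ℕ)
    (v : V) : GainsTowards (F.X v) (x v) ((-1) ^ t) 0 (F.finalValue t v) :=
  (gainsTowards_add_sum hF _ fun _ hc =>
    gainsTowards_message hF h t (mem_conNbrs.2 (mem_varNbrs.1 hc))).mono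
    fun _ _ hβ => h.reducedCost_gain_nonneg hβ

theorem mem_packingDelta {t β : ℕ} :
    β ∈ F.packingDelta t v ↔
      β ∈ range (F.X v + 1) ∧ IsMaxOn (F.finalValue t v) (range (F.X v + 1)) β := by
  rw [packingDelta, mem_filter]
  refine and_congr_right fun hβ => ⟨fun h β' hβ' => ?_, fun h => ?_⟩
  · exact (le_sup hβ').trans_eq h.symm
  · exact (le_sup hβ).antisymm (Finset.sup_le fun β' hβ' => h hβ')

theorem packingDelta_nonempty (F : FactorGraphModel V C) (t : ℕ) (v : V) :
    (F.packingDelta t v).Nonempty := by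
  obtain ⟨β, hβ, hmax⟩ := exists_max_image (range (F.X v + 1)) (F.finalValue t v) (by simp)
  exact ⟨β, mem_packingDelta.2 ⟨hβ, hmax⟩⟩

theorem exists_mem_packingDelta_sub_nonpos (hF : F.IsPacking d w) (h : F.IsOptimalPair d w x y)
    (t : ℕ) (v : V) : ∃ β ∈ F.packingDelta t v, (-1) ^ t * (x v - β) ≤ 0 := by
  set s : ℤˣ := (-1) ^ t with hs
  obtain ⟨β, hβ, hlast⟩ := exists_max_image (F.packingDelta t v) (fun β : ℕ => (s * β : ℤ))
    (F.packingDelta_nonempty t v)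
  obtain ⟨hβX, hmax⟩ := mem_packingDelta.1 hβ
  obtain ⟨hx₀, hxX⟩ := h.mem_packingPolytope.2 v
  refine ⟨β, hβ, ?_⟩
  by_contra! hpos
  obtain ⟨β', hβ'⟩ := exists_isStepTowards (s := s) hx₀ hxX (mem_range_succ_iff.1 hβX)
    (by simpa [hs] using hpos)
  have hle := gainsTowards_finalValue hF h t v hβ'
  rw [WithBot.coe_zero, add_zero] at hle
  have hmem : β' ∈ F.packingDelta t v := mem_packingDelta.2
    ⟨mem_range_succ_iff.2 hβ'.target_le, fun γ hγ => (hmax hγ).trans hle⟩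
  have hβs := hlast β' hmem
  rw [hβ'.target_eq, mul_add, Int.units_coe_mul_self] at hβs
  linarith

end Messages

end FactorGraphModel

section Covering

variable {m n : ℕ} {A : Matrix (Fin m) (Fin n) ℤ} {b d : Fin m → ℤ} {w : Fin n → ℝ} {X : Fin n → ℕ}

theorem conNbrs_packingModel (c : Fin m) :
    (packingModel A d w X).conNbrs c = ({i | A c i = 1} : Finset (Fin n)) := by
  ext i
  rw [FactorGraphModel.mem_conNbrs, mem_filter_univ]
  rfl

theorem isPacking_packingModel : (packingModel A d w X).IsPacking d w where
  ψ_eq_zero_iff c z := by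
    rw [conNbrs_packingModel]
    simp only [packingModel]
    split_ifs with h
    · simpa using by convert h
    · simpa using by convert not_le.1 h
  φ_eq _ _ := rfl

theorem sum_mul_eq_sum_conNbrs (hA : ∀ j i, A j i = 0 ∨ A j i = 1) (j : Fin m) (x : Fin n → ℝ) :
    ∑ i, (A j i : ℝ) * x i = ∑ i ∈ (packingModel A d w X).conNbrs j, x i := by
  rw [conNbrs_packingModel, sum_filter]
  refine sum_congr rfl fun i _ => ?_
  rcases hA j i with h | h <;> simp [h]

/-- The right-hand side `A X - b` of the packing problem complementary to the covering problem. -/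
def complementaryRhs (A : Matrix (Fin m) (Fin n) ℤ) (b : Fin m → ℤ) (X : Fin n → ℕ) : Fin m → ℤ :=
  A.mulVec (fun i => (X i : ℤ)) - b

theorem complement_mem_packingPolytope_iff (hA : ∀ j i, A j i = 0 ∨ A j i = 1) {x : Fin n → ℝ} :
    (fun i => X i - x i) ∈ (packingModel A (complementaryRhs A b X) w X).packingPolytope
        (complementaryRhs A b X) ↔ x ∈ coveringFeasible A b X := by
  have hd (j : Fin m) : (complementaryRhs A b X j : ℝ) = ∑ i, (A j i : ℝ) * X i - b j := by
    simp [complementaryRhs, Matrix.mulVec, dotProduct]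
  refine and_congr (forall_congr' fun j => ?_) (forall_congr' fun i => ?_)
  · rw [← sum_mul_eq_sum_conNbrs hA, hd]
    simp only [mul_sub, sum_sub_distrib, sub_le_sub_iff_left]
  · simp only [packingModel, sub_nonneg, sub_le_self_iff, and_comm]

theorem exists_isOptimalPair_of_mem_coveringOpt (hA : ∀ j i, A j i = 0 ∨ A j i = 1)
    {x : Fin n → ℝ} (hx : x ∈ coveringOpt A b w X) :
    ∃ y, (packingModel A (complementaryRhs A b X) w X).IsOptimalPair (complementaryRhs A b X) w
      (fun i => X i - x i) y := by
  refine FactorGraphModel.exists_isOptimalPair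
    ((complement_mem_packingPolytope_iff hA).2 hx.1) fun z hz => ?_
  have hle := hx.2 (fun i => X i - z i)
    ((complement_mem_packingPolytope_iff hA).1 (by simpa only [sub_sub_cancel] using hz))
  simp only [mul_sub, sum_sub_distrib] at hle ⊢
  linarith

theorem coveringDelta_nonempty (t : ℕ) (r : Fin n) : (coveringDelta A b w X t r).Nonempty :=
  (FactorGraphModel.packingDelta_nonempty _ t r).image _

theorem exists_mem_coveringDelta_sub_nonpos (hA : ∀ j i, A j i = 0 ∨ A j i = 1) {x : Fin n → ℝ}
    (hx : x ∈ coveringOpt A b w X) (t : ℕ) (r : Fin n) :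
    ∃ δ ∈ coveringDelta A b w X t r, (-1) ^ t * (δ - x r) ≤ 0 := by
  obtain ⟨y, hy⟩ := exists_isOptimalPair_of_mem_coveringOpt hA hx
  obtain ⟨β, hβ, hle⟩ :=
    FactorGraphModel.exists_mem_packingDelta_sub_nonpos isPacking_packingModel hy t r
  have hβX : β ≤ X r := mem_range_succ_iff.1 (FactorGraphModel.mem_packingDelta.1 hβ).1
  refine ⟨X r - β, mem_image_of_mem _ hβ, ?_⟩
  rwa [Nat.cast_sub hβX, sub_right_comm]

theorem isCompact_coveringFeasible (A : Matrix (Fin m) (Fin n) ℤ) (b : Fin m → ℤ)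
    (X : Fin n → ℕ) : IsCompact (coveringFeasible A b X) := by
  have hbox : IsCompact (Set.Icc 0 fun i => (X i : ℝ)) := isCompact_Icc
  refine hbox.of_isClosed_subset ?_ fun x hx => ⟨fun i => (hx.2 i).1, fun i => (hx.2 i).2⟩
  simp only [coveringFeasible, Set.ofPred_and, Set.ofPred_forall]
  refine .inter (isClosed_iInter fun j => isClosed_le ?_ ?_)
    (isClosed_iInter fun i => .inter (isClosed_le ?_ ?_) (isClosed_le ?_ ?_)) <;> fun_prop

theorem isCompact_coveringOpt (A : Matrix (Fin m) (Fin n) ℤ) (b : Fin m → ℤ) (w : Fin n → ℝ)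
    (X : Fin n → ℕ) : IsCompact (coveringOpt A b w X) := by
  have hclosed : IsClosed {x : Fin n → ℝ |
      ∀ y ∈ coveringFeasible A b X, ∑ i, w i * x i ≤ ∑ i, w i * y i} := by
    simp only [Set.ofPred_forall]
    exact isClosed_biInter fun y _ => isClosed_le (by fun_prop) (by fun_prop)
  exact (isCompact_coveringFeasible A b X).inter_right hclosed

theorem coveringOpt_nonempty (h : (coveringFeasible A b X).Nonempty) :
    (coveringOpt A b w X).Nonempty := by
  obtain ⟨x, hx, hmin⟩ := (isCompact_coveringFeasible A b X).exists_isMinOn h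
    (f := fun x => ∑ i, w i * x i) (by fun_prop)
  exact ⟨x, hx, fun y hy => hmin hy⟩

end Covering

end MinSum

theorem theorem2 {m n : ℕ} (A : Matrix (Fin m) (Fin n) ℤ)
    (hA : ∀ j i, A j i = 0 ∨ A j i = 1) (b : Fin m → ℤ) (w : Fin n → ℝ) (X : Fin n → ℕ)
    (hfeas : (MinSum.coveringFeasible A b X).Nonempty) (t : ℕ) (r : Fin n) :
    (Even t → ∃ (δmin : ℕ) (xmin : ℝ),
      IsLeast (MinSum.coveringDelta A b w X t r : Set ℕ) δmin ∧
      IsLeast ((fun x : Fin n → ℝ => x r) '' MinSum.coveringOpt A b w X) xmin ∧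
      (δmin : ℝ) ≤ xmin) ∧
    (Odd t → ∃ (δmax : ℕ) (xmax : ℝ),
      IsGreatest (MinSum.coveringDelta A b w X t r : Set ℕ) δmax ∧
      IsGreatest ((fun x : Fin n → ℝ => x r) '' MinSum.coveringOpt A b w X) xmax ∧
      xmax ≤ (δmax : ℝ)) := by
  have hδ := MinSum.coveringDelta_nonempty (A := A) (b := b) (w := w) (X := X) t r
  have hcompact := (MinSum.isCompact_coveringOpt A b w X).image (continuous_apply r)
  have hopt := (MinSum.coveringOpt_nonempty (w := w) hfeas).image fun x => x r
  refine ⟨fun ht => ?_, fun ht => ?_⟩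
  · obtain ⟨xmin, hxmin⟩ := hcompact.exists_isLeast hopt
    have hδmin := Finset.isLeast_min' _ hδ
    obtain ⟨x, hx, rfl⟩ := hxmin.1
    obtain ⟨δ, hδ, hle⟩ := MinSum.exists_mem_coveringDelta_sub_nonpos hA hx t r
    rw [ht.neg_one_pow, one_mul, sub_nonpos] at hle
    exact ⟨_, _, hδmin, hxmin, (Nat.cast_le.2 (hδmin.2 hδ)).trans hle⟩
  · obtain ⟨xmax, hxmax⟩ := hcompact.exists_isGreatest hopt
    have hδmax := Finset.isGreatest_max' _ hδ
    obtain ⟨x, hx, rfl⟩ := hxmax.1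
    obtain ⟨δ, hδ, hle⟩ := MinSum.exists_mem_coveringDelta_sub_nonpos hA hx t r
    rw [ht.neg_one_pow, neg_one_mul, neg_nonpos, sub_nonneg] at hle
    exact ⟨_, _, hδmax, hxmax, hle.trans (Nat.cast_le.2 (hδmax.2 hδ))⟩
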